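/- Consider the discrete-time single-server bulk queue with infinite buffer in which, in each slot independently, a group of customers arrives with probability $\lambda$, $0<\lambda\le 1$; the group sizes are independent with $\Pr(X=k)=g_k$, $k\ge1$, generating function $G(z)=\sum_{k\ge 1} g_kz^k$ and finite mean $\bar g=\sum_k k g_k$. Customers are served in batches under the $(a,b)$ rule, $1\le a\le b$: if $n\ge a$ customers are waiting when a service is to start, then $\min(n,b)$ of them are served. A batch of $r$ customers ($a\le r\le b$) receives a first essential service (FES), which lasts a random number of slots $\ge1$ with mean $\bar S_r<\infty$. At its completion each customer of the batch independently opts with probability $p\in(0,1)$ for a second optional service (SOS), so that $y$ of them do so with probability $\chi_{r,y}=\binom ry p^y(1-p)^{r-y}$; if $y\ge 1$, these $y$ customers receive an SOS, which lasts a random number of slots $\ge1$ with mean $\bar S^O_y<\infty$. If the server, having completed all the services of a batch, finds $k<a$ customers in the queue, it takes a vacation of type $k$, which lasts a random number of slots $\ge1$ with finite mean. If fewer than $a$ customers are waiting at the end of a vacation, then the server takes another vacation, of the type given by the current queue length (multiple vacations), or stays dormant until at least $a$ customers are present (single vacation), one of these two policies being fixed throughout; otherwise an FES starts. All service and vacation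 times and arrivals are independent; the arrivals in the last slot of a service or vacation are counted in the queue at its completion. Let $K^b$ and $T^y$ be the generating functions of the number of customers arriving during an FES of $b$ customers and during an SOS of $y$ customers, and put $$D(z)=z^b-\Big(\chi_{b,0}+\sum_{y=1}^b\chi_{b,y}T^y(z)\Big)K^b(z),\qquad \rho=\frac{\lambda\bar g\left(\bar S_b+\sum_{y=1}^b\chi_{b,y}\bar S^O_y\right)}{b}.$$ Consider the Markov chain embedded at the completion epochs of FES, SOS and vacations, whose state records the kind of the epoch, the queue length just after it, and the size of the batch or group just served, or the type of the vacation just finished. Then the left derivative of $D$ at $z=1$ is $b(1-\rho)$; in other words, the left derivative at $1$ of $\big(\chi_{b,0}+\sum_{y}\chi_{b,y}T^y(z)\big)K^b(z)$ is $b\rho$, which is less than $b$ if and only if $\rho<1$. If $\rho<1$, then the embedded chain is ergodic, in the following sense. From every state some irreducible (closed communicating) class of states can be reached, and every irreducible class is positive recurrent; and if moreover $\lambda<1$, then the set of all states that can be reached from the empty system (that is, from the state in which a vacation of type $0$ has just ended with an empty queue) is closed, and the chain on it is irreducible, aperiodic and positive recurrent. -/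

import Mathlib

open scoped ENNReal

noncomputable section

/-! ### Markov chains on a (countable) type, given by their transition laws -/

namespace MarkovChain

variable {S : Type}

/-- The law of the chain after `n` steps, started from `x`. -/
def stepN (P : S → PMF S) : ℕ → S → PMF S
  | 0, x => PMF.pure x
  | n + 1, x => (P x).bind (stepN P n)

/-- `y` is accessible from `x` (in zero or more steps). -/
def Accessible (P : S → PMF S) (x y : S) : Prop :=
  ∃ n, stepN P n x y ≠ 0

/-- A nonempty closed set of states that all communicate. -/
def IsIrreducibleClass (P : S → PMF S) (C : Set S) : Prop :=
  C.Nonempty ∧ (∀ x ∈ C, ∀ y, Accessible P x y → y ∈ C) ∧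
    ∀ x ∈ C, ∀ y ∈ C, Accessible P x y

/-- The greatest common divisor of the possible return times to `x` is one. -/
def IsAperiodicAt (P : S → PMF S) (x : S) : Prop :=
  ∀ d : ℕ, (∀ n, 1 ≤ n → stepN P n x x ≠ 0 → d ∣ n) → d = 1

open Classical in
/-- `firstPassage P y n x` is the probability that the chain started from `x` visits `y` at
time `n + 1` and at none of the times `1, …, n`. -/
def firstPassage (P : S → PMF S) (y : S) : ℕ → S → ℝ≥0∞
  | 0, x => P x y
  | n + 1, x => ∑' z, if z = y then 0 else P x z * firstPassage P y n z

/-- The chain started from `x` returns to `x` almost surely, and the mean return time is finite. -/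
def IsPositiveRecurrentAt (P : S → PMF S) (x : S) : Prop :=
  ∑' n, firstPassage P x n x = 1 ∧ ∑' n : ℕ, ((n : ℝ≥0∞) + 1) * firstPassage P x n x ≠ ⊤

/-- The chain, restricted to the set of states `C`, is ergodic: `C` is closed, and the chain
on `C` is irreducible, aperiodic and positive recurrent. -/
def IsErgodicOn (P : S → PMF S) (C : Set S) : Prop :=
  IsIrreducibleClass P C ∧ ∀ x ∈ C, IsAperiodicAt P x ∧ IsPositiveRecurrentAt P x

end MarkovChain

/-! ### Distributions on the natural numbers -/

namespace BulkQueue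

/-- A Bernoulli trial with success probability `q`. -/
def coin (q : ℝ) (h0 : 0 ≤ q) (h1 : q ≤ 1) : PMF Bool :=
  PMF.ofFintype (fun c => ENNReal.ofReal (if c then q else 1 - q)) (by
    rw [Fintype.sum_bool, ← ENNReal.ofReal_add] <;> simp [h0, h1])

/-- The binomial probability `χ_{r,y}` that `y` out of `r` customers opt for the second service,
each of them with probability `p`. -/
def chi (p : ℝ) (r y : ℕ) : ℝ := (r.choose y : ℝ) * p ^ y * (1 - p) ^ (r - y)

/-- The number of customers, out of `r`, that opt for the second service. -/
def optCount (p : ℝ) (h0 : 0 ≤ p) (h1 : p ≤ 1) (r : ℕ) : PMF (Fin (r + 1)) :=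
  PMF.ofFintype (fun y => ENNReal.ofReal (chi p r y)) (by
    rw [← ENNReal.ofReal_sum_of_nonneg]
    · have h := add_pow p (1 - p) r
      rw [add_sub_cancel, one_pow, ← Fin.sum_univ_eq_sum_range
        (fun y => p ^ y * (1 - p) ^ (r - y) * (r.choose y : ℝ))] at h
      rw [← ENNReal.ofReal_one, h]
      congr 1
      exact Finset.sum_congr rfl fun y _ => by unfold chi; ring
    · intro y _
      have : 0 ≤ 1 - p := sub_nonneg.2 h1
      unfold chi
      positivity)

/-- The distribution `q` has a finite mean. -/
def HasFiniteMean (q : PMF ℕ) : Prop := Summable fun n : ℕ => (n : ℝ) * (q n).toReal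

/-- The mean of `q` (used only for distributions of finite mean). -/
def mean (q : PMF ℕ) : ℝ := ∑' n : ℕ, (n : ℝ) * (q n).toReal

/-- The probability generating function of `q`. -/
def pgf (q : PMF ℕ) (z : ℝ) : ℝ := ∑' n : ℕ, (q n).toReal * z ^ n

/-! ### The queueing model -/

/-- Single vacation or multiple vacations. -/
inductive VacationPolicy
  | single
  | multiple

/-- The parameters of the discrete-time queue with compound Bernoulli arrivals, bulk service of
between `a` and `b` customers, a first essential service whose duration depends on the batch size,
a second optional service whose duration depends on the number of customers opting for it, and
vacations whose duration depends on the queue length at their start. -/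
structure Model where
  /-- minimal batch size -/
  a : ℕ
  /-- maximal batch size -/
  b : ℕ
  one_le_a : 1 ≤ a
  a_le_b : a ≤ b
  /-- probability that a group of customers arrives in a given slot -/
  lam : ℝ
  lam_pos : 0 < lam
  lam_le_one : lam ≤ 1
  /-- law of the size of an arriving group -/
  group : PMF ℕ
  group_zero : group 0 = 0
  group_mean : HasFiniteMean group
  /-- probability that a customer opts for the second service -/
  p : ℝ
  p_pos : 0 < p
  p_lt_one : p < 1
  /-- law of the duration, in slots, of the first service of a batch of `r` customers -/
  fesTime : ℕ → PMF ℕ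
  fesTime_zero : ∀ r, a ≤ r → r ≤ b → fesTime r 0 = 0
  fesTime_mean : ∀ r, a ≤ r → r ≤ b → HasFiniteMean (fesTime r)
  /-- law of the duration, in slots, of the second service of `j` customers -/
  sosTime : ℕ → PMF ℕ
  sosTime_zero : ∀ j, 1 ≤ j → j ≤ b → sosTime j 0 = 0
  sosTime_mean : ∀ j, 1 ≤ j → j ≤ b → HasFiniteMean (sosTime j)
  /-- law of the duration, in slots, of a vacation that starts with `k` customers waiting -/
  vacTime : ℕ → PMF ℕ
  vacTime_zero : ∀ k, k < a → vacTime k 0 = 0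
  vacTime_mean : ∀ k, k < a → HasFiniteMean (vacTime k)
  policy : VacationPolicy

namespace Model

/-- The states of the system at the completion epochs. In all three cases `n` is the number of
customers in the queue at the epoch. -/
inductive State (a b : ℕ) : Type
  /-- a first service, of a batch of `r` customers, has just been completed -/
  | fes (n : ℕ) (r : Finset.Icc a b) : State a b
  /-- a second service, of `j` customers, has just been completed -/
  | sos (n : ℕ) (j : Finset.Icc 1 b) : State a b
  /-- a vacation that started with `k` customers waiting has just been completed -/
  | vac (n : ℕ) (k : Fin a) : State a b

variable (M : Model)

/-- The number of customers arriving in one slot. -/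
def slotArrivals : PMF ℕ :=
  (coin M.lam M.lam_pos.le M.lam_le_one).bind fun c => if c then M.group else PMF.pure 0

/-- The number of customers arriving in `ℓ` slots. -/
def arrivalsIn : ℕ → PMF ℕ
  | 0 => PMF.pure 0
  | ℓ + 1 => (arrivalsIn ℓ).bind fun m => M.slotArrivals.map fun i => m + i

/-- The number of customers arriving during an independent time with law `T`. -/
def arrivalsDuring (T : PMF ℕ) : PMF ℕ := T.bind M.arrivalsIn

/-- The queue length at the end of a dormant period that starts with `n` customers in the queue:
groups join until at least `a` customers are present. The first argument bounds the number
of groups; `a` of them always suffice, as groups are nonempty. -/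
def dormantEnd : ℕ → ℕ → PMF ℕ
  | 0, n => PMF.pure n
  | f + 1, n => if M.a ≤ n then PMF.pure n else M.group.bind fun i => dormantEnd f (n + i)

/-- A first service starts with `n ≥ a` customers in the queue: `min n b` of them are served, and
the next epoch is the completion of this service. (The value for `n < a` is not used.) -/
def startFES (n : ℕ) : PMF (State M.a M.b) :=
  let r : Finset.Icc M.a M.b := ⟨max M.a (min n M.b),
    Finset.mem_Icc.2 ⟨le_max_left _ _, max_le M.a_le_b (min_le_right _ _)⟩⟩
  (M.arrivalsDuring (M.fesTime r)).map fun i => State.fes (n - r + i) r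

/-- A second service of `j` customers starts with `n` customers in the queue. -/
def startSOS (n : ℕ) (j : Finset.Icc 1 M.b) : PMF (State M.a M.b) :=
  (M.arrivalsDuring (M.sosTime j)).map fun i => State.sos (n + i) j

/-- A vacation starts with `n < a` customers in the queue. -/
def startVac (n : Fin M.a) : PMF (State M.a M.b) :=
  (M.arrivalsDuring (M.vacTime n)).map fun i => State.vac (n + i) n

/-- The server has completed all the services of a batch and finds `n` customers in the queue. -/
def afterService (n : ℕ) : PMF (State M.a M.b) :=
  if h : n < M.a then M.startVac ⟨n, h⟩ else M.startFES n

/-- The server returns from a vacation and finds `n` customers in the queue. -/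
def afterVacation (n : ℕ) : PMF (State M.a M.b) :=
  if h : n < M.a then
    match M.policy with
    | VacationPolicy.single => (M.dormantEnd M.a n).bind M.startFES
    | VacationPolicy.multiple => M.startVac ⟨n, h⟩
  else M.startFES n

/-- The transition law of the Markov chain embedded at the completion epochs of first services,
second services and vacations. -/
def step : State M.a M.b → PMF (State M.a M.b)
  | State.fes n r =>
      (optCount M.p M.p_pos.le M.p_lt_one.le r).bind fun y =>
        if h : (y : ℕ) = 0 then M.afterService n
        else M.startSOS n ⟨y, Finset.mem_Icc.2
          ⟨Nat.one_le_iff_ne_zero.2 h, (Nat.lt_succ_iff.1 y.2).trans (Finset.mem_Icc.1 r.2).2⟩⟩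
  | State.sos n _ => M.afterService n
  | State.vac n _ => M.afterVacation n

/-- The state in which a vacation that started with an empty queue ends with an empty queue. -/
def empty : State M.a M.b := State.vac 0 ⟨0, M.one_le_a⟩

/-- The traffic intensity. -/
def rho : ℝ :=
  M.lam * mean M.group *
    (mean (M.fesTime M.b) + ∑ y ∈ Finset.Icc 1 M.b, chi M.p M.b y * mean (M.sosTime y)) / M.b

/-- The generating function of the number of customers arriving during a time with law `T`, that
is, the generating function of `T` evaluated at `1 - λ + λ G(z)`. -/
def arrivalsPgf (T : PMF ℕ) (z : ℝ) : ℝ := pgf T (1 - M.lam + M.lam * pgf M.group z)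

/-- The denominator `z ^ b - (χ_{b,0} + ∑ y, χ_{b,y} T^y(z)) K^b(z)` of the generating function of
the queue length at service completion. -/
def denominator (z : ℝ) : ℝ :=
  z ^ M.b -
    (chi M.p M.b 0 +
        ∑ y ∈ Finset.Icc 1 M.b, chi M.p M.b y * M.arrivalsPgf (M.sosTime y) z) *
      M.arrivalsPgf (M.fesTime M.b) z

end Model

end BulkQueue

end

/-! The number `b (1 - ρ)` is `b` minus the mean number of arrivals during the first and second
services of a full batch. It appears as the left derivative of `denominator` because a generating
function has its mean as left derivative at one, by dominated convergence (`hasDerivWithinAt_pgf`).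

It is also the mean fall of the queue in a full service, which gives recurrence by Foster's
criterion. The queue length alone is not a Lyapunov function, since it grows during a second
service. `potential` therefore charges the expected arrivals of the second service in advance,
together with half of the drift. The other half is left for the first service, so every step from a
queue of at least `b` lowers the potential by at least `halfDrift` (`expect_step_add_le`). The
exceptional set is finite but the chain need not be irreducible, so Foster's criterion is proved for
each closed class (`IsLyapunov.isPositiveRecurrentAt`), and the existence of such classes
separately.

For `λ < 1` an arithmetic invariant, `IsAttainable`, holds at all states reached from the empty
system: finitely many further groups make the queue length a multiple of `b`. Admitting these groups
only while fewer than `a` customers wait lets the services clear the queue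
(`exists_accessible_fes_zero`). From there the empty state follows in one step, or in two through a
second service, which yields irreducibility and aperiodicity. -/

namespace MarkovChain

variable {S : Type}

/-! ### Expectations -/

/-- The expectation of `f` under `q`. -/
noncomputable def expect {α : Type} (q : PMF α) (f : α → ℝ≥0∞) : ℝ≥0∞ := ∑' x, q x * f x

section Expect

variable {α β : Type}

theorem expect_pure (x : α) (f : α → ℝ≥0∞) : expect (PMF.pure x) f = f x := by
  classical
  rw [expect, tsum_eq_single x]
  · simp
  · intro y hy
    simp [PMF.pure_apply, hy]

theorem expect_bind (q : PMF α) (k : α → PMF β) (f : β → ℝ≥0∞) :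
    expect (q.bind k) f = expect q fun x => expect (k x) f := by
  simp only [expect, PMF.bind_apply, ← ENNReal.tsum_mul_right, ← ENNReal.tsum_mul_left]
  rw [ENNReal.tsum_comm]
  simp only [mul_assoc]

theorem expect_map (q : PMF α) (g : α → β) (f : β → ℝ≥0∞) :
    expect (q.map g) f = expect q (f ∘ g) := by
  rw [PMF.map, expect_bind]
  simp only [Function.comp_apply, expect_pure, Function.comp_def]

theorem expect_const (q : PMF α) (c : ℝ≥0∞) : expect q (fun _ => c) = c := by
  rw [expect, ENNReal.tsum_mul_right, PMF.tsum_coe, one_mul]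

theorem expect_add (q : PMF α) (f g : α → ℝ≥0∞) :
    expect q (fun x => f x + g x) = expect q f + expect q g := by
  simp only [expect, mul_add, ENNReal.tsum_add]

theorem expect_mul_left (q : PMF α) (c : ℝ≥0∞) (f : α → ℝ≥0∞) :
    expect q (fun x => c * f x) = c * expect q f := by
  simp only [expect, ← ENNReal.tsum_mul_left]
  exact tsum_congr fun x => by ring

theorem expect_mul_right (q : PMF α) (c : ℝ≥0∞) (f : α → ℝ≥0∞) :
    expect q (fun x => f x * c) = expect q f * c := by
  simp only [expect, ← ENNReal.tsum_mul_right, mul_assoc]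

theorem expect_mono {q : PMF α} {f g : α → ℝ≥0∞} (h : ∀ x, q x ≠ 0 → f x ≤ g x) :
    expect q f ≤ expect q g := by
  refine ENNReal.tsum_le_tsum fun x => ?_
  by_cases hx : q x = 0
  · simp [hx]
  · gcongr
    exact h x hx

theorem expect_congr {q : PMF α} {f g : α → ℝ≥0∞} (h : ∀ x, q x ≠ 0 → f x = g x) :
    expect q f = expect q g :=
  le_antisymm (expect_mono fun x hx => (h x hx).le) (expect_mono fun x hx => (h x hx).ge)

theorem expect_le_const {q : PMF α} {f : α → ℝ≥0∞} {c : ℝ≥0∞} (h : ∀ x, q x ≠ 0 → f x ≤ c) :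
    expect q f ≤ c :=
  (expect_mono h).trans (expect_const q c).le

end Expect

/-! ### Accessibility -/

theorem stepN_succ_ne_zero {P : S → PMF S} {n : ℕ} {x y : S} :
    stepN P (n + 1) x y ≠ 0 ↔ ∃ z, P x z ≠ 0 ∧ stepN P n z y ≠ 0 := by
  rw [stepN, ← PMF.mem_support_iff, PMF.mem_support_bind_iff]
  rfl

theorem stepN_add_ne_zero {P : S → PMF S} {m n : ℕ} {x y z : S} (h₁ : stepN P m x y ≠ 0)
    (h₂ : stepN P n y z ≠ 0) : stepN P (m + n) x z ≠ 0 := by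
  induction m generalizing x with
  | zero =>
    classical
    have : y = x := by
      by_contra hne
      exact h₁ (by simp [stepN, PMF.pure_apply, hne])
    subst this
    simpa using h₂
  | succ m ih =>
    obtain ⟨w, hw, hwy⟩ := stepN_succ_ne_zero.1 h₁
    rw [add_right_comm]
    exact stepN_succ_ne_zero.2 ⟨w, hw, ih hwy⟩

theorem stepN_one_ne_zero {P : S → PMF S} {x y : S} (h : P x y ≠ 0) : stepN P 1 x y ≠ 0 :=
  stepN_succ_ne_zero.2 ⟨y, h, by simp [stepN]⟩

theorem Accessible.refl (P : S → PMF S) (x : S) : Accessible P x x :=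
  ⟨0, by simp [stepN]⟩

theorem Accessible.trans {P : S → PMF S} {x y z : S} (h₁ : Accessible P x y)
    (h₂ : Accessible P y z) : Accessible P x z := by
  obtain ⟨m, hm⟩ := h₁
  obtain ⟨n, hn⟩ := h₂
  exact ⟨m + n, stepN_add_ne_zero hm hn⟩

theorem Accessible.of_step {P : S → PMF S} {x y : S} (h : P x y ≠ 0) : Accessible P x y :=
  ⟨1, stepN_one_ne_zero h⟩

theorem Accessible.head {P : S → PMF S} {x y z : S} (h : P x y ≠ 0) (h' : Accessible P y z) :
    Accessible P x z :=
  (Accessible.of_step h).trans h'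

theorem Accessible.eq_or_exists_step {P : S → PMF S} {x y : S} (h : Accessible P x y) :
    x = y ∨ ∃ z, P x z ≠ 0 ∧ Accessible P z y := by
  obtain ⟨n, hn⟩ := h
  cases n with
  | zero =>
    classical
    left
    by_contra hne
    exact hn (by simp [stepN, PMF.pure_apply, Ne.symm hne])
  | succ n =>
    obtain ⟨z, hz, hzy⟩ := stepN_succ_ne_zero.1 hn
    exact Or.inr ⟨z, hz, n, hzy⟩

/-- A property that is preserved by the transitions holds at all accessible states. -/
theorem Accessible.induction {P : S → PMF S} {p : S → Prop}
    (hp : ∀ x y, p x → P x y ≠ 0 → p y) {x y : S} (h : Accessible P x y) (hx : p x) : p y := by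
  obtain ⟨n, hn⟩ := h
  induction n generalizing x with
  | zero =>
    classical
    have : y = x := by
      by_contra hne
      exact hn (by simp [stepN, PMF.pure_apply, hne])
    exact this ▸ hx
  | succ n ih =>
    obtain ⟨z, hz, hzy⟩ := stepN_succ_ne_zero.1 hn
    exact ih (hp x z hx hz) hzy

/-- The set of states accessible from `x` is an irreducible class if they all lead back to `x`. -/
theorem isIrreducibleClass_accessible {P : S → PMF S} {x : S}
    (h : ∀ y, Accessible P x y → Accessible P y x) :
    IsIrreducibleClass P {y | Accessible P x y} :=
  ⟨⟨x, Accessible.refl P x⟩, fun _ hy _ hz => Accessible.trans hy hz,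
    fun y hy _ hz => (h y hy).trans hz⟩

/-! ### Survival probabilities and mean return times -/

/-- The probability that the chain started from `x` avoids `y` at the times `1, …, n`. -/
noncomputable def survival (P : S → PMF S) (y : S) : ℕ → S → ℝ≥0∞
  | 0, _ => 1
  | n + 1, x => expect (P x) (({y}ᶜ : Set S).indicator (survival P y n))

/-- The mean of the minimum of `n` and the first time `≥ 1` at which the chain visits `y`. -/
noncomputable def truncatedMean (P : S → PMF S) (y : S) (n : ℕ) (x : S) : ℝ≥0∞ :=
  ∑ k ∈ Finset.range n, survival P y k x

theorem survival_le_one (P : S → PMF S) (y : S) (n : ℕ) (x : S) : survival P y n x ≤ 1 := by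
  induction n generalizing x with
  | zero => exact le_rfl
  | succ n ih =>
    exact expect_le_const fun z _ => (Set.indicator_le_self _ _ z).trans (ih z)

theorem survival_succ_le (P : S → PMF S) (y : S) (n : ℕ) (x : S) :
    survival P y (n + 1) x ≤ survival P y n x := by
  induction n generalizing x with
  | zero => exact survival_le_one P y 1 x
  | succ n ih =>
    exact expect_mono fun z _ => Set.indicator_le_indicator (ih z)

theorem survival_antitone (P : S → PMF S) (y x : S) : Antitone fun n => survival P y n x :=
  antitone_nat_of_succ_le fun n => survival_succ_le P y n x

/-- The two events are disjoint: one excludes a visit to `y` at time `n + 1`, the other demands it.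
-/
theorem survival_add_stepN_le (P : S → PMF S) (y : S) (n : ℕ) (x : S) :
    survival P y (n + 1) x + stepN P (n + 1) x y ≤ 1 := by
  induction n generalizing x with
  | zero =>
    have h : stepN P 1 x y = expect (P x) fun z => PMF.pure z y := by
      rw [stepN, PMF.bind_apply]
      rfl
    rw [h, survival, ← expect_add]
    refine expect_le_const fun z _ => ?_
    classical
    by_cases hz : z = y
    · simp [hz]
    · simp [hz, survival, PMF.pure_apply, Ne.symm hz]
  | succ n ih =>
    have h : stepN P (n + 1 + 1) x y = expect (P x) fun z => stepN P (n + 1) z y := by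
      rw [stepN, PMF.bind_apply]
      rfl
    rw [h, survival, ← expect_add]
    exact expect_le_const fun z _ =>
      (add_le_add_left (Set.indicator_le_self _ _ z) _).trans (ih z)

theorem survival_lt_one {P : S → PMF S} {y : S} {n : ℕ} {x : S}
    (h : stepN P (n + 1) x y ≠ 0) : survival P y (n + 1) x < 1 := by
  refine lt_of_lt_of_le ?_ (survival_add_stepN_le P y n x)
  exact ENNReal.lt_add_right
    (ne_top_of_le_ne_top ENNReal.one_ne_top (survival_le_one P y _ x)) h

theorem firstPassage_add_survival (P : S → PMF S) (y : S) (n : ℕ) (x : S) :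
    firstPassage P y n x + survival P y (n + 1) x = survival P y n x := by
  classical
  induction n generalizing x with
  | zero =>
    have h : P x y = expect (P x) (({y} : Set S).indicator fun _ => 1) := by
      rw [expect, tsum_eq_single y]
      · simp
      · intro z hz
        simp [hz]
    rw [firstPassage, h, survival.eq_2, ← expect_add, survival]
    refine (expect_congr fun z _ => ?_).trans (expect_const (P x) 1)
    by_cases hz : z = y <;> simp [hz, survival]
  | succ n ih =>
    have h : firstPassage P y (n + 1) x =
        expect (P x) (({y}ᶜ : Set S).indicator (firstPassage P y n)) := by
      rw [firstPassage, expect]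
      refine tsum_congr fun z => ?_
      by_cases hz : z = y <;> simp [hz]
    rw [h, survival, ← expect_add, survival]
    refine expect_congr fun z _ => ?_
    by_cases hz : z = y
    · simp [hz]
    · simpa [hz] using ih z

/-- First-step analysis; the indicator stops the clock when the chain hits `y`. -/
theorem truncatedMean_succ (P : S → PMF S) (y : S) (n : ℕ) (x : S) :
    truncatedMean P y (n + 1) x =
      1 + expect (P x) (({y}ᶜ : Set S).indicator (truncatedMean P y n)) := by
  induction n with
  | zero =>
    have h : ({y}ᶜ : Set S).indicator (truncatedMean P y 0) = fun _ => 0 := by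
      ext z
      simp [truncatedMean]
    rw [h, expect_const]
    simp [truncatedMean, survival]
  | succ n ih =>
    rw [truncatedMean, Finset.sum_range_succ, ← truncatedMean, ih, survival, add_assoc,
      ← expect_add]
    congr 2
    ext z
    by_cases hz : z = y
    · simp [hz]
    · simp [hz, truncatedMean, Finset.sum_range_succ]

theorem truncatedMean_mono (P : S → PMF S) (y x : S) :
    Monotone fun n => truncatedMean P y n x :=
  fun _ _ h => Finset.sum_le_sum_of_subset (Finset.range_mono h)

theorem truncatedMean_le (P : S → PMF S) (y : S) (n : ℕ) (x : S) :
    truncatedMean P y n x ≤ n := by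
  refine (Finset.sum_le_sum fun k _ => survival_le_one P y k x).trans ?_
  simp

theorem sum_firstPassage_add_survival (P : S → PMF S) (y : S) (n : ℕ) (x : S) :
    ∑ k ∈ Finset.range n, firstPassage P y k x + survival P y n x = 1 := by
  induction n with
  | zero => simp [survival]
  | succ n ih => rw [Finset.sum_range_succ, add_assoc, firstPassage_add_survival, ih]

/-- Summation by parts: the mean of the stopped return time computed from its law and from its
tails. -/
theorem sum_mul_firstPassage_add (P : S → PMF S) (y : S) (n : ℕ) (x : S) :
    ∑ k ∈ Finset.range n, ((k : ℝ≥0∞) + 1) * firstPassage P y k x + n * survival P y n x =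
      truncatedMean P y n x := by
  induction n with
  | zero => simp [truncatedMean]
  | succ n ih =>
    rw [Finset.sum_range_succ, truncatedMean, Finset.sum_range_succ, ← truncatedMean, ← ih,
      ← firstPassage_add_survival P y n x]
    push_cast
    ring

theorem isPositiveRecurrentAt_of_truncatedMean_le {P : S → PMF S} {x : S} {c : ℝ≥0∞}
    (hc : c ≠ ⊤) (h : ∀ n, truncatedMean P x n x ≤ c) : IsPositiveRecurrentAt P x := by
  have hs : ∑' n, survival P x n x ≠ ⊤ :=
    ne_top_of_le_ne_top hc (ENNReal.tsum_le_of_sum_range_le h)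
  constructor
  · have h0 := ENNReal.tendsto_atTop_zero_of_tsum_ne_top hs
    have h1 : Filter.Tendsto (fun n => ∑ k ∈ Finset.range n, firstPassage P x k x)
        Filter.atTop (nhds (∑' k, firstPassage P x k x)) := ENNReal.summable.tendsto_sum_tsum_nat
    have h2 := h1.add h0
    simp only [sum_firstPassage_add_survival, add_zero] at h2
    exact tendsto_nhds_unique h2 tendsto_const_nhds
  · refine ne_top_of_le_ne_top hc (ENNReal.tsum_le_of_sum_range_le fun n => ?_)
    refine le_trans ?_ (h n)
    rw [← sum_mul_firstPassage_add]
    exact le_self_add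

/-! ### Foster's criterion -/

/-- Foster's drift condition: outside of the finite set `F` the function `V` decreases on average
by at least one in each step. -/
structure IsLyapunov (P : S → PMF S) (V : S → ℝ≥0∞) (F : Set S) : Prop where
  finite : F.Finite
  ne_top : ∀ x, V x ≠ ⊤
  drift : ∀ x ∉ F, expect (P x) V + 1 ≤ V x
  expect_ne_top : ∀ x ∈ F, expect (P x) V ≠ ⊤

namespace IsLyapunov

variable {P : S → PMF S} {V : S → ℝ≥0∞} {F : Set S}

/-- If `F` were never reached, the drift inequality could be iterated forever, forcing `V x` above
every natural number. -/
theorem exists_accessible (h : IsLyapunov P V F) (x : S) : ∃ f ∈ F, Accessible P x f := by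
  by_contra hx
  push Not at hx
  have key : ∀ n : ℕ, ∀ x, (∀ f ∈ F, ¬ Accessible P x f) → (n : ℝ≥0∞) ≤ V x := by
    intro n
    induction n with
    | zero => simp
    | succ n ih =>
      intro x hx
      refine le_trans ?_ (h.drift x fun hF => hx x hF (Accessible.refl P x))
      push_cast
      gcongr
      rw [← expect_const (P x) (n : ℝ≥0∞)]
      exact expect_mono fun z hz => ih z fun f hf hzf => hx f hf (Accessible.head hz hzf)
  obtain ⟨n, hn⟩ := ENNReal.exists_nat_gt (h.ne_top x)
  exact absurd (key n x hx) hn.not_ge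

theorem exists_isIrreducibleClass (h : IsLyapunov P V F) (x : S) :
    ∃ C, IsIrreducibleClass P C ∧ ∃ y ∈ C, Accessible P x y := by
  let reach : S → Set S := fun f => {g ∈ F | Accessible P f g}
  obtain ⟨f₀, hf₀, hxf₀⟩ := h.exists_accessible x
  have hfin : (reach x).Finite := h.finite.subset fun _ hg => hg.1
  -- Moving along a path can only shrink `reach`. Where its cardinality is minimal it is constant
  -- along paths, so every path from `f` can be continued back to `f`.
  obtain ⟨f, ⟨hfF, hxf⟩, hmin⟩ := Set.exists_min_image (reach x) (fun f => (reach f).ncard) hfin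
    ⟨f₀, hf₀, hxf₀⟩
  refine ⟨{y | Accessible P f y}, isIrreducibleClass_accessible fun y hy => ?_, f,
    Accessible.refl P f, hxf⟩
  obtain ⟨g, hg, hyg⟩ := h.exists_accessible y
  have hfg : Accessible P f g := hy.trans hyg
  have hsub : reach g ⊆ reach f := fun k hk => ⟨hk.1, hfg.trans hk.2⟩
  have heq : reach g = reach f :=
    Set.eq_of_subset_of_ncard_le hsub (hmin g ⟨hg, hxf.trans hfg⟩)
      (h.finite.subset fun _ hk => hk.1)
  have hfg' : f ∈ reach g := heq ▸ ⟨hfF, Accessible.refl P f⟩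
  exact hyg.trans hfg'.2

theorem exists_expect_le (h : IsLyapunov P V F) :
    ∃ β : ℝ≥0∞, β ≠ ⊤ ∧ ∀ x, expect (P x) V ≤ V x + β := by
  refine ⟨h.finite.toFinset.sup fun x => expect (P x) V, ?_, fun x => ?_⟩
  · rw [← lt_top_iff_ne_top, Finset.sup_lt_iff ENNReal.zero_lt_top]
    intro x hx
    exact (h.expect_ne_top x (h.finite.mem_toFinset.1 hx)).lt_top
  · by_cases hx : x ∈ F
    · exact (Finset.le_sup (f := fun x => expect (P x) V)
        (h.finite.mem_toFinset.2 hx)).trans le_add_self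
    · exact le_self_add.trans ((h.drift x hx).trans le_self_add)

/-- Outside `F` each unit of time is paid for by a unit of `V`; on entering `F` the bound `M` takes
over. -/
theorem truncatedMean_le_add {C : Set S} (h : IsLyapunov P V F)
    (hC : ∀ x ∈ C, ∀ z, P x z ≠ 0 → z ∈ C) (y : S) {n : ℕ} {M : ℝ≥0∞}
    (hM : ∀ f ∈ F ∩ C, truncatedMean P y n f ≤ M) :
    ∀ x ∈ C, truncatedMean P y n x ≤ V x + M := by
  induction n with
  | zero => simp [truncatedMean]
  | succ n ih =>
    intro x hx
    by_cases hF : x ∈ F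
    · exact (hM x ⟨hF, hx⟩).trans le_add_self
    have ih' := ih fun f hf => (truncatedMean_mono P y f n.le_succ).trans (hM f hf)
    rw [truncatedMean_succ]
    calc 1 + expect (P x) (({y}ᶜ : Set S).indicator (truncatedMean P y n))
        ≤ 1 + expect (P x) (fun z => V z + M) := by
          gcongr
          exact expect_mono fun z hz =>
            (Set.indicator_le_self _ _ z).trans (ih' z (hC x hx z hz))
      _ = expect (P x) V + 1 + M := by
          rw [expect_add, expect_const]
          ring
      _ ≤ V x + M := by
          gcongr
          exact h.drift x hF

/-- Each of the first `N` steps costs one unit of time and raises `V` by at most `β` on average. The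
gain is that `M` is incurred only if `y` has been avoided for `N` steps. -/
theorem truncatedMean_add_le {C : Set S} (hC : ∀ x ∈ C, ∀ z, P x z ≠ 0 → z ∈ C) (y : S) {n : ℕ}
    {M β : ℝ≥0∞} (hβ : ∀ x, expect (P x) V ≤ V x + β)
    (hM : ∀ x ∈ C, truncatedMean P y n x ≤ V x + M) (N : ℕ) :
    ∀ x ∈ C, truncatedMean P y (n + N) x ≤ N * (1 + β) + V x + survival P y N x * M := by
  induction N with
  | zero => simpa [survival] using hM
  | succ N ih =>
    intro x hx
    rw [← add_assoc, truncatedMean_succ]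
    calc 1 + expect (P x) (({y}ᶜ : Set S).indicator (truncatedMean P y (n + N)))
        ≤ 1 + expect (P x) (fun z => (N * (1 + β) + V z) +
            ({y}ᶜ : Set S).indicator (survival P y N) z * M) := by
          gcongr
          refine expect_mono fun z hz => ?_
          by_cases hzy : z = y
          · simp [hzy]
          · simpa [hzy] using ih z (hC x hx z hz)
      _ = 1 + N * (1 + β) + expect (P x) V + survival P y (N + 1) x * M := by
          rw [expect_add, expect_add, expect_const, expect_mul_right, survival]
          ring
      _ ≤ 1 + N * (1 + β) + (V x + β) + survival P y (N + 1) x * M := by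
          gcongr
          exact hβ x
      _ = _ := by
          push_cast
          ring

theorem exists_survival_lt_one {C : Set S} (hC : IsIrreducibleClass P C) {x y : S} (hx : x ∈ C)
    (hy : y ∈ C) : ∃ n, survival P y n x < 1 := by
  obtain ⟨z, hz⟩ := (P x).support_nonempty
  obtain ⟨n, hn⟩ := hC.2.2 z (hC.2.1 x hx z (Accessible.of_step hz)) y hy
  exact ⟨n + 1, survival_lt_one (stepN_succ_ne_zero.2 ⟨z, hz, hn⟩)⟩

theorem _root_.ENNReal.le_div_of_le_add_mul {m c σ : ℝ≥0∞} (hm : m ≠ ⊤) (hσ : σ < 1)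
    (h : m ≤ c + σ * m) : m ≤ c / (1 - σ) := by
  have hσm : σ * m ≠ ⊤ := ENNReal.mul_ne_top hσ.ne_top hm
  rw [ENNReal.le_div_iff_mul_le (Or.inl (tsub_pos_of_lt hσ).ne')
    (Or.inl (ne_top_of_le_ne_top ENNReal.one_ne_top tsub_le_self)), mul_comm,
    ENNReal.sub_mul fun _ _ => hm, one_mul]
  exact tsub_le_iff_right.2 h

/-- With `m n` the maximum of the truncated mean over `F ∩ C`, the two preceding bounds combine to
`m n ≤ c + σ * m n` with `σ < 1` and with `c`, `σ` independent of `n`. Truncation makes `m n`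
finite, so the inequality can be solved. -/
theorem isPositiveRecurrentAt (h : IsLyapunov P V F) {C : Set S} (hC : IsIrreducibleClass P C)
    {y : S} (hy : y ∈ C) : IsPositiveRecurrentAt P y := by
  have hcl : ∀ x ∈ C, ∀ z, P x z ≠ 0 → z ∈ C :=
    fun x hx z hz => hC.2.1 x hx z (Accessible.of_step hz)
  obtain ⟨β, hβ, hβV⟩ := h.exists_expect_le
  have hfin : (F ∩ C).Finite := h.finite.subset Set.inter_subset_left
  let K := hfin.toFinset
  have hK : ∀ f ∈ K, f ∈ F ∩ C := fun f hf => hfin.mem_toFinset.1 hf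
  choose! t ht using fun f (hf : f ∈ C) => exists_survival_lt_one hC hf hy
  -- One horizon serves all of the finite set, because survival probabilities decrease in time.
  let N := K.sup t
  let σ := K.sup (survival P y N)
  have hσ : σ < 1 := by
    rw [Finset.sup_lt_iff (by simp)]
    intro f hf
    exact (survival_antitone P y f (Finset.le_sup hf)).trans_lt (ht f (hK f hf).2)
  let v := K.sup V
  have hv : v ≠ ⊤ := by
    rw [← lt_top_iff_ne_top, Finset.sup_lt_iff ENNReal.zero_lt_top]
    exact fun f _ => (h.ne_top f).lt_top
  let c := N * (1 + β) + v
  have hc : c ≠ ⊤ := by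
    refine ENNReal.add_ne_top.2 ⟨ENNReal.mul_ne_top (ENNReal.natCast_ne_top N) ?_, hv⟩
    exact ENNReal.add_ne_top.2 ⟨ENNReal.one_ne_top, hβ⟩
  let m : ℕ → ℝ≥0∞ := fun n => K.sup (truncatedMean P y n)
  have hum : ∀ n, ∀ x ∈ C, truncatedMean P y n x ≤ V x + m n := fun n =>
    h.truncatedMean_le_add hcl y fun f hf => Finset.le_sup (hfin.mem_toFinset.2 hf)
  have hmb : ∀ n, m n ≤ c / (1 - σ) := by
    intro n
    have hmn : m n ≤ n := Finset.sup_le fun f _ => truncatedMean_le P y n f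
    refine ENNReal.le_div_of_le_add_mul (ne_top_of_le_ne_top (ENNReal.natCast_ne_top n) hmn) hσ ?_
    refine Finset.sup_le fun f hf => ?_
    refine (truncatedMean_mono P y f (n.le_add_right N)).trans ?_
    refine (truncatedMean_add_le hcl y hβV (hum n) N f (hK f hf).2).trans ?_
    exact add_le_add (add_le_add le_rfl (Finset.le_sup (f := V) hf))
      (mul_le_mul_left (Finset.le_sup (f := survival P y N) hf) _)
  refine isPositiveRecurrentAt_of_truncatedMean_le (c := V y + c / (1 - σ)) ?_ fun n =>
    (hum n y hy).trans (add_le_add_right (hmb n) _)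
  exact ENNReal.add_ne_top.2 ⟨h.ne_top y, ENNReal.div_ne_top hc (tsub_pos_of_lt hσ).ne'⟩

end IsLyapunov

end MarkovChain

namespace BulkQueue

/-! ### Generating functions and their derivatives at one -/

theorem summable_toReal (q : PMF ℕ) : Summable fun n => (q n).toReal :=
  ENNReal.summable_toReal q.tsum_coe_ne_top

theorem tsum_toReal (q : PMF ℕ) : ∑' n, (q n).toReal = 1 := by
  rw [← ENNReal.tsum_toReal_eq fun n => q.apply_ne_top n, q.tsum_coe, ENNReal.toReal_one]

theorem pgf_one (q : PMF ℕ) : pgf q 1 = 1 := by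
  simp [pgf, tsum_toReal]

theorem summable_pgf (q : PMF ℕ) {z : ℝ} (hz : z ∈ Set.Icc (0 : ℝ) 1) :
    Summable fun n : ℕ => (q n).toReal * z ^ n :=
  (summable_toReal q).of_nonneg_of_le
    (fun n => mul_nonneg ENNReal.toReal_nonneg (pow_nonneg hz.1 n))
    fun _ => mul_le_of_le_one_right ENNReal.toReal_nonneg (pow_le_one₀ hz.1 hz.2)

theorem pgf_mem_Icc (q : PMF ℕ) {z : ℝ} (hz : z ∈ Set.Icc (0 : ℝ) 1) :
    pgf q z ∈ Set.Icc (0 : ℝ) 1 := by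
  constructor
  · exact tsum_nonneg fun n => mul_nonneg ENNReal.toReal_nonneg (pow_nonneg hz.1 n)
  · rw [← tsum_toReal q]
    exact (summable_pgf q hz).tsum_le_tsum
      (fun _ => mul_le_of_le_one_right ENNReal.toReal_nonneg (pow_le_one₀ hz.1 hz.2))
      (summable_toReal q)

/-- The slope at one is `∑ q n (1 + z + ⋯ + z ^ (n - 1))`, dominated on `[0, 1]` by the summable `n
q n`. To the right of one the series may diverge. -/
theorem hasDerivWithinAt_pgf {q : PMF ℕ} (hq : HasFiniteMean q) :
    HasDerivWithinAt (pgf q) (mean q) (Set.Icc 0 1) 1 := by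
  rw [hasDerivWithinAt_iff_tendsto_slope]
  have hlim : Filter.Tendsto
      (fun z : ℝ => ∑' n : ℕ, (q n).toReal * ∑ i ∈ Finset.range n, z ^ i)
      (nhdsWithin 1 (Set.Icc 0 1 \ {1})) (nhds (mean q)) := by
    refine tendsto_tsum_of_dominated_convergence hq ?_ ?_
    · intro n
      have hc : Continuous fun z : ℝ => (q n).toReal * ∑ i ∈ Finset.range n, z ^ i := by fun_prop
      have := hc.tendsto 1
      simp only [one_pow, Finset.sum_const, Finset.card_range, nsmul_eq_mul, mul_one] at this
      rw [mul_comm]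
      exact this.mono_left nhdsWithin_le_nhds
    · filter_upwards [self_mem_nhdsWithin] with z hz
      intro n
      have h0 : 0 ≤ ∑ i ∈ Finset.range n, z ^ i :=
        Finset.sum_nonneg fun i _ => pow_nonneg hz.1.1 i
      rw [Real.norm_of_nonneg (mul_nonneg ENNReal.toReal_nonneg h0), mul_comm]
      refine mul_le_mul_of_nonneg_right ?_ ENNReal.toReal_nonneg
      refine (Finset.sum_le_sum fun i _ => pow_le_one₀ hz.1.1 hz.1.2).trans ?_
      simp
  refine hlim.congr' ?_
  filter_upwards [self_mem_nhdsWithin] with z hz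
  have hz1 : z - 1 ≠ 0 := sub_ne_zero.2 hz.2
  have hsub : pgf q z - 1 = ∑' n : ℕ, ((q n).toReal * z ^ n - (q n).toReal) := by
    rw [(summable_pgf q hz.1).tsum_sub (summable_toReal q), tsum_toReal, pgf]
  rw [slope_def_field, pgf_one, eq_div_iff hz1, hsub, ← tsum_mul_right]
  refine tsum_congr fun n => ?_
  rw [mul_assoc, geom_sum_mul]
  ring

/-! ### The derivative of the denominator at one -/

namespace Model

variable (M : Model)

theorem arrivalsPgf_one (T : PMF ℕ) : M.arrivalsPgf T 1 = 1 := by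
  simp [arrivalsPgf, pgf_one]

theorem hasDerivWithinAt_arrivalsPgf {T : PMF ℕ} (hT : HasFiniteMean T) :
    HasDerivWithinAt (M.arrivalsPgf T) (M.lam * mean M.group * mean T) (Set.Icc 0 1) 1 := by
  have hin : HasDerivWithinAt (fun z => 1 - M.lam + M.lam * pgf M.group z)
      (M.lam * mean M.group) (Set.Icc 0 1) 1 :=
    ((hasDerivWithinAt_pgf M.group_mean).const_mul M.lam).const_add _
  -- The chain rule within `[0, 1]` needs the inner function, a convex combination of `1` and `G z`,
  -- to stay there.
  have hmaps : Set.MapsTo (fun z => 1 - M.lam + M.lam * pgf M.group z) (Set.Icc 0 1)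
      (Set.Icc 0 1) := by
    intro z hz
    obtain ⟨h0, h1⟩ := pgf_mem_Icc M.group hz
    have := M.lam_pos
    have := M.lam_le_one
    constructor <;> nlinarith
  have hout : HasDerivWithinAt (pgf T) (mean T) (Set.Icc 0 1)
      (1 - M.lam + M.lam * pgf M.group 1) := by
    simpa [pgf_one] using hasDerivWithinAt_pgf hT
  rw [mul_comm]
  exact hout.comp 1 hin hmaps

theorem _root_.BulkQueue.chi_zero_add_sum (p : ℝ) (r : ℕ) :
    chi p r 0 + ∑ y ∈ Finset.Icc 1 r, chi p r y = 1 := by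
  have h := add_pow p (1 - p) r
  rw [add_sub_cancel, one_pow] at h
  rw [h, Finset.range_eq_Ico, Finset.sum_eq_sum_Ico_succ_bot (Nat.succ_pos r)]
  have : Finset.Ico (0 + 1) (r + 1) = Finset.Icc 1 r := by
    ext i
    simp
  rw [this]
  congr 1
  · simp [chi]
  · exact Finset.sum_congr rfl fun y _ => by unfold chi; ring

theorem b_pos : 0 < M.b := M.one_le_a.trans M.a_le_b

theorem b_mul_rho : (M.b : ℝ) * M.rho = M.lam * mean M.group *
    (mean (M.fesTime M.b) + ∑ y ∈ Finset.Icc 1 M.b, chi M.p M.b y * mean (M.sosTime y)) := by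
  rw [rho, mul_div_cancel₀]
  exact_mod_cast M.b_pos.ne'

theorem hasDerivWithinAt_denominator :
    HasDerivWithinAt M.denominator ((M.b : ℝ) * (1 - M.rho)) (Set.Iic 1) 1 := by
  suffices h : HasDerivWithinAt M.denominator ((M.b : ℝ) * (1 - M.rho)) (Set.Icc 0 1) 1 from
    h.mono_of_mem_nhdsWithin (Icc_mem_nhdsLE zero_lt_one)
  have hK := M.hasDerivWithinAt_arrivalsPgf (M.fesTime_mean M.b M.a_le_b le_rfl)
  have hT : HasDerivWithinAt
      (fun z => chi M.p M.b 0 +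
        ∑ y ∈ Finset.Icc 1 M.b, chi M.p M.b y * M.arrivalsPgf (M.sosTime y) z)
      (∑ y ∈ Finset.Icc 1 M.b, chi M.p M.b y * (M.lam * mean M.group * mean (M.sosTime y)))
      (Set.Icc 0 1) 1 := by
    refine HasDerivWithinAt.const_add _ (HasDerivWithinAt.fun_sum fun y hy => ?_)
    rw [Finset.mem_Icc] at hy
    exact (M.hasDerivWithinAt_arrivalsPgf (M.sosTime_mean y hy.1 hy.2)).const_mul _
  have hD := ((hasDerivAt_pow M.b (1 : ℝ)).hasDerivWithinAt (s := Set.Icc 0 1)).sub (hT.mul hK)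
  refine hD.congr_deriv ?_
  simp only [arrivalsPgf_one, mul_one, one_pow]
  rw [chi_zero_add_sum, mul_sub, b_mul_rho, mul_add, Finset.mul_sum, mul_one, one_mul, add_comm]
  congr 2
  refine Finset.sum_congr rfl fun y _ => by ring

end Model

end BulkQueue

namespace BulkQueue

open MarkovChain

/-! ### The drift of the queue length -/

theorem expect_natCast {q : PMF ℕ} (hq : HasFiniteMean q) :
    expect q (fun n => (n : ℝ≥0∞)) = ENNReal.ofReal (mean q) := by
  rw [mean, ENNReal.ofReal_tsum_of_nonneg (fun n => by positivity) hq, expect]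
  refine tsum_congr fun n => ?_
  rw [ENNReal.ofReal_mul n.cast_nonneg, ENNReal.ofReal_natCast,
    ENNReal.ofReal_toReal (q.apply_ne_top n), mul_comm]

theorem mean_nonneg (q : PMF ℕ) : 0 ≤ mean q := tsum_nonneg fun n => by positivity

theorem chi_nonneg {p : ℝ} (h0 : 0 ≤ p) (h1 : p ≤ 1) (r y : ℕ) : 0 ≤ chi p r y := by
  have : 0 ≤ 1 - p := sub_nonneg.2 h1
  unfold chi
  positivity

namespace Model

variable (M : Model)

/-- The mean number of customers arriving during a time with law `T`. -/
noncomputable def load (T : PMF ℕ) : ℝ≥0∞ := ENNReal.ofReal (M.lam * mean M.group * mean T)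

theorem load_ne_top (T : PMF ℕ) : M.load T ≠ ⊤ := ENNReal.ofReal_ne_top

theorem expect_slotArrivals :
    expect M.slotArrivals (fun n => (n : ℝ≥0∞)) = ENNReal.ofReal (M.lam * mean M.group) := by
  rw [slotArrivals, expect_bind, expect, tsum_bool]
  simp only [Bool.false_eq_true, if_false, if_true, expect_pure, expect_natCast M.group_mean]
  simp [coin, ENNReal.ofReal_mul M.lam_pos.le]

theorem expect_arrivalsIn (l : ℕ) :
    expect (M.arrivalsIn l) (fun n => (n : ℝ≥0∞)) =
      l * ENNReal.ofReal (M.lam * mean M.group) := by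
  induction l with
  | zero => simp [arrivalsIn, expect_pure]
  | succ l ih =>
    simp only [arrivalsIn, expect_bind, expect_map, Function.comp_def, Nat.cast_add, expect_add,
      expect_const, expect_slotArrivals, ih]
    push_cast
    ring

/-- Wald's identity, for a duration independent of the arrivals. -/
theorem expect_arrivalsDuring {T : PMF ℕ} (hT : HasFiniteMean T) :
    expect (M.arrivalsDuring T) (fun n => (n : ℝ≥0∞)) = M.load T := by
  simp only [arrivalsDuring, expect_bind, expect_arrivalsIn, expect_mul_right, expect_natCast hT]
  rw [load, mul_comm, ENNReal.ofReal_mul (mul_nonneg M.lam_pos.le (mean_nonneg _))]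

/-- The mean number of customers arriving during the second service, if any, that follows the
first service of a batch of `r` customers. -/
noncomputable def sosLoad (r : ℕ) : ℝ≥0∞ :=
  expect (optCount M.p M.p_pos.le M.p_lt_one.le r)
    fun y => if (y : ℕ) = 0 then 0 else M.load (M.sosTime y)

theorem sosLoad_eq (r : ℕ) :
    M.sosLoad r = ENNReal.ofReal
      (M.lam * mean M.group * ∑ y ∈ Finset.Icc 1 r, chi M.p r y * mean (M.sosTime y)) := by
  have hsum : ∑ y ∈ Finset.Icc 1 r, chi M.p r y * mean (M.sosTime y) =
      ∑ i : Fin r, chi M.p r (i + 1) * mean (M.sosTime (i + 1)) := by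
    rw [Fin.sum_univ_eq_sum_range (fun i => chi M.p r (i + 1) * mean (M.sosTime (i + 1))) r,
      Finset.range_eq_Ico, Finset.sum_Ico_add' (fun i => chi M.p r i * mean (M.sosTime i)) 0 r 1]
    refine Finset.sum_congr ?_ fun _ _ => rfl
    ext i
    simp
  have hg : 0 ≤ M.lam * mean M.group := mul_nonneg M.lam_pos.le (mean_nonneg _)
  have hchi := chi_nonneg M.p_pos.le M.p_lt_one.le
  rw [hsum, Finset.mul_sum, ENNReal.ofReal_sum_of_nonneg fun i _ =>
    mul_nonneg hg (mul_nonneg (hchi _ _) (mean_nonneg _)), sosLoad, expect, tsum_fintype,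
    Fin.sum_univ_succ]
  simp only [Fin.val_zero, if_true, mul_zero, zero_add, Fin.val_succ, Nat.add_eq_zero_iff,
    one_ne_zero, and_false, if_false]
  refine Finset.sum_congr rfl fun i _ => ?_
  rw [load, optCount, PMF.ofFintype_apply, ← ENNReal.ofReal_mul (hchi _ _), Fin.val_succ]
  congr 1
  ring

theorem sosLoad_ne_top (r : ℕ) : M.sosLoad r ≠ ⊤ := by
  rw [sosLoad_eq]
  exact ENNReal.ofReal_ne_top

/-- Half of the mean decrease of the queue length in a full service. -/
noncomputable def halfDrift : ℝ≥0∞ := ENNReal.ofReal ((M.b : ℝ) * (1 - M.rho) / 2)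

theorem halfDrift_ne_top : M.halfDrift ≠ ⊤ := ENNReal.ofReal_ne_top

theorem halfDrift_ne_zero (h : M.rho < 1) : M.halfDrift ≠ 0 := by
  have hb : (0 : ℝ) < M.b := Nat.cast_pos.2 M.b_pos
  rw [halfDrift, Ne, ENNReal.ofReal_eq_zero, not_le]
  exact div_pos (mul_pos hb (sub_pos.2 h)) two_pos

/-- This is `b ρ + b (1 - ρ) = b`; `ρ < 1` keeps `ENNReal.ofReal` from truncating the drift to zero.
-/
theorem load_add_sosLoad_add_drift (h : M.rho < 1) :
    M.load (M.fesTime M.b) + M.sosLoad M.b + M.halfDrift + M.halfDrift = M.b := by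
  have hb : (0 : ℝ) < M.b := Nat.cast_pos.2 M.b_pos
  have hd : 0 ≤ (M.b : ℝ) * (1 - M.rho) / 2 :=
    (div_pos (mul_pos hb (sub_pos.2 h)) two_pos).le
  have hg : 0 ≤ M.lam * mean M.group := mul_nonneg M.lam_pos.le (mean_nonneg _)
  have hK : 0 ≤ M.lam * mean M.group * mean (M.fesTime M.b) := mul_nonneg hg (mean_nonneg _)
  have hT : 0 ≤ M.lam * mean M.group *
      ∑ y ∈ Finset.Icc 1 M.b, chi M.p M.b y * mean (M.sosTime y) :=
    mul_nonneg hg (Finset.sum_nonneg fun y _ =>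
      mul_nonneg (chi_nonneg M.p_pos.le M.p_lt_one.le _ _) (mean_nonneg _))
  rw [sosLoad_eq, load, halfDrift, ← ENNReal.ofReal_add hK hT,
    ← ENNReal.ofReal_add (add_nonneg hK hT) hd,
    ← ENNReal.ofReal_add (add_nonneg (add_nonneg hK hT) hd) hd, ← ENNReal.ofReal_natCast]
  congr 1
  have := M.b_mul_rho
  linarith

/-! ### The Lyapunov function -/

/-- The number of customers in the queue. -/
def State.queue {a b : ℕ} : State a b → ℕ
  | State.fes n _ => n
  | State.sos n _ => n
  | State.vac n _ => n

/-- The queue length, increased after a first service by the mean number of customers that will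
arrive during the second service. -/
noncomputable def potential : State M.a M.b → ℝ≥0∞
  | State.fes n r => n + (M.sosLoad r + M.halfDrift)
  | State.sos n _ => n
  | State.vac n _ => n

theorem potential_ne_top (x : State M.a M.b) : M.potential x ≠ ⊤ := by
  cases x <;> simp [potential, sosLoad_ne_top, halfDrift_ne_top]

theorem expect_startSOS (n : ℕ) (j : Finset.Icc 1 M.b) :
    expect (M.startSOS n j) M.potential = n + M.load (M.sosTime j) := by
  obtain ⟨h1, hb⟩ := Finset.mem_Icc.1 j.2
  simp only [startSOS, expect_map, Function.comp_def, potential, Nat.cast_add, expect_add,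
    expect_const, M.expect_arrivalsDuring (M.sosTime_mean j h1 hb)]

theorem expect_startVac (n : Fin M.a) :
    expect (M.startVac n) M.potential = (n : ℕ) + M.load (M.vacTime n) := by
  simp only [startVac, expect_map, Function.comp_def, potential, Nat.cast_add, expect_add,
    expect_const, M.expect_arrivalsDuring (M.vacTime_mean n n.2)]

theorem expect_startFES (n : ℕ) :
    expect (M.startFES n) M.potential =
      (n - max M.a (min n M.b) : ℕ) + M.load (M.fesTime (max M.a (min n M.b))) +
        (M.sosLoad (max M.a (min n M.b)) + M.halfDrift) := by
  simp only [startFES, expect_map, Function.comp_def, potential, Nat.cast_add, expect_add,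
    expect_const]
  rw [M.expect_arrivalsDuring (M.fesTime_mean _ (le_max_left _ _)
    (max_le M.a_le_b (min_le_right _ _)))]

theorem expect_startFES_add (h : M.rho < 1) {n : ℕ} (hn : M.b ≤ n) :
    expect (M.startFES n) M.potential + M.halfDrift = n := by
  rw [expect_startFES, min_eq_right hn, max_eq_right M.a_le_b]
  calc _ = ((n - M.b : ℕ) : ℝ≥0∞) +
        (M.load (M.fesTime M.b) + M.sosLoad M.b + M.halfDrift + M.halfDrift) := by ring
    _ = n := by
      rw [M.load_add_sosLoad_add_drift h, ← Nat.cast_add, Nat.sub_add_cancel hn]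

theorem afterService_of_le {n : ℕ} (hn : M.a ≤ n) : M.afterService n = M.startFES n := by
  rw [afterService, dif_neg hn.not_gt]

theorem afterVacation_of_le {n : ℕ} (hn : M.a ≤ n) : M.afterVacation n = M.startFES n := by
  rw [afterVacation, dif_neg hn.not_gt]

/-- The constant `c` must cover both outcomes: nobody opts, or a second service starts with `n`
still waiting. -/
theorem expect_step_fes_le {n : ℕ} {c : ℝ≥0∞} (hc : expect (M.afterService n) M.potential ≤ c)
    (hn : n ≤ c) (r : Finset.Icc M.a M.b) :
    expect (M.step (State.fes n r)) M.potential ≤ c + M.sosLoad r := by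
  rw [step, expect_bind, sosLoad, ← expect_const (optCount M.p M.p_pos.le M.p_lt_one.le r) c,
    ← expect_add]
  refine expect_mono fun y _ => ?_
  by_cases hy : (y : ℕ) = 0
  · simpa only [hy, dif_pos, if_true, add_zero] using hc
  · simp only [hy, dif_neg, not_false_eq_true, if_false, expect_startSOS]
    gcongr

/-- After a first service, the `sosLoad` in the potential pays for the second service and the stored
`halfDrift` is released. Any other step starts a full first service, which gains twice `halfDrift`
and stores one of them. -/
theorem expect_step_add_le (h : M.rho < 1) (x : State M.a M.b) (hx : M.b ≤ x.queue) :
    expect (M.step x) M.potential + M.halfDrift ≤ M.potential x := by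
  cases x with
  | fes n r =>
    have hn : M.b ≤ n := hx
    rw [potential, ← add_assoc]
    gcongr
    refine M.expect_step_fes_le ?_ le_rfl r
    rw [M.afterService_of_le (M.a_le_b.trans hn), ← M.expect_startFES_add h hn]
    exact le_self_add
  | sos n j =>
    have hn : M.b ≤ n := hx
    rw [step, M.afterService_of_le (M.a_le_b.trans hn), M.expect_startFES_add h hn, potential]
  | vac n k =>
    have hn : M.b ≤ n := hx
    rw [step, M.afterVacation_of_le (M.a_le_b.trans hn), M.expect_startFES_add h hn, potential]

/-- The bound is uniform in `n`, so that it can be averaged over the random queue length ending a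
dormant period. -/
theorem exists_expect_startFES_le :
    ∃ c : ℝ≥0∞, c ≠ ⊤ ∧ ∀ n : ℕ, expect (M.startFES n) M.potential ≤ n + c := by
  refine ⟨∑ r ∈ Finset.Icc M.a M.b, (M.load (M.fesTime r) + (M.sosLoad r + M.halfDrift)),
    ?_, fun n => ?_⟩
  · simp [load_ne_top, sosLoad_ne_top, halfDrift_ne_top]
  · rw [expect_startFES, add_assoc]
    refine add_le_add (by exact_mod_cast Nat.sub_le _ _) ?_
    exact Finset.single_le_sum
      (f := fun r => M.load (M.fesTime r) + (M.sosLoad r + M.halfDrift)) (fun _ _ => zero_le)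
      (Finset.mem_Icc.2 ⟨le_max_left _ _, max_le M.a_le_b (min_le_right _ _)⟩)

theorem expect_dormantEnd_le (f n : ℕ) :
    expect (M.dormantEnd f n) (fun n => (n : ℝ≥0∞)) ≤
      n + f * ENNReal.ofReal (mean M.group) := by
  induction f generalizing n with
  | zero => simp [dormantEnd, expect_pure]
  | succ f ih =>
    rw [dormantEnd]
    split_ifs with hn
    · rw [expect_pure]
      exact le_self_add
    · rw [expect_bind]
      refine (expect_mono fun i _ => ih (n + i)).trans ?_
      simp only [Nat.cast_add, expect_add, expect_const, expect_natCast M.group_mean]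
      refine le_of_eq ?_
      push_cast
      ring

theorem expect_startVac_ne_top (n : Fin M.a) : expect (M.startVac n) M.potential ≠ ⊤ := by
  simp [expect_startVac, load_ne_top]

theorem expect_startFES_ne_top (n : ℕ) : expect (M.startFES n) M.potential ≠ ⊤ := by
  obtain ⟨c, hc, hle⟩ := M.exists_expect_startFES_le
  exact ne_top_of_le_ne_top (by simp [hc]) (hle n)

theorem expect_afterService_ne_top (n : ℕ) : expect (M.afterService n) M.potential ≠ ⊤ := by
  rw [afterService]
  split_ifs with hn
  · exact M.expect_startVac_ne_top _
  · exact M.expect_startFES_ne_top n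

theorem expect_afterVacation_ne_top (n : ℕ) : expect (M.afterVacation n) M.potential ≠ ⊤ := by
  rw [afterVacation]
  split_ifs with hn
  · cases M.policy with
    | single =>
      obtain ⟨c, hc, hle⟩ := M.exists_expect_startFES_le
      simp only [expect_bind]
      refine ne_top_of_le_ne_top ?_ (expect_mono fun m _ => hle m)
      rw [expect_add, expect_const]
      refine ENNReal.add_ne_top.2 ⟨ne_top_of_le_ne_top ?_ (M.expect_dormantEnd_le M.a n), hc⟩
      simp [ENNReal.mul_eq_top]
    | multiple => exact M.expect_startVac_ne_top _
  · exact M.expect_startFES_ne_top n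

theorem expect_step_ne_top (x : State M.a M.b) : expect (M.step x) M.potential ≠ ⊤ := by
  cases x with
  | fes n r =>
    refine ne_top_of_le_ne_top ?_ (M.expect_step_fes_le
      (c := expect (M.afterService n) M.potential + n) le_self_add le_add_self r)
    simp [expect_afterService_ne_top, sosLoad_ne_top]
  | sos n j => exact M.expect_afterService_ne_top n
  | vac n k => exact M.expect_afterVacation_ne_top n

theorem finite_queue_lt {a b : ℕ} (N : ℕ) : {x : State a b | x.queue < N}.Finite := by
  refine ((Set.finite_range fun q : Fin N × Finset.Icc a b => State.fes (q.1 : ℕ) q.2).union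
    ((Set.finite_range fun q : Fin N × Finset.Icc 1 b => State.sos (q.1 : ℕ) q.2).union
    (Set.finite_range fun q : Fin N × Fin a => State.vac (q.1 : ℕ) q.2))).subset ?_
  intro x hx
  cases x with
  | fes n r => exact Or.inl ⟨(⟨n, hx⟩, r), rfl⟩
  | sos n j => exact Or.inr (Or.inl ⟨(⟨n, hx⟩, j), rfl⟩)
  | vac n k => exact Or.inr (Or.inr ⟨(⟨n, hx⟩, k), rfl⟩)

theorem isLyapunov (h : M.rho < 1) :
    IsLyapunov M.step (fun x => M.halfDrift⁻¹ * M.potential x) {x | x.queue < M.b} where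
  finite := finite_queue_lt M.b
  ne_top x := ENNReal.mul_ne_top (ENNReal.inv_ne_top.2 (M.halfDrift_ne_zero h))
    (M.potential_ne_top x)
  drift x hx := by
    rw [expect_mul_left, ← ENNReal.inv_mul_cancel (M.halfDrift_ne_zero h) M.halfDrift_ne_top,
      ← mul_add]
    gcongr
    exact M.expect_step_add_le h x (not_lt.1 hx)
  expect_ne_top x _ := by
    rw [expect_mul_left]
    exact ENNReal.mul_ne_top (ENNReal.inv_ne_top.2 (M.halfDrift_ne_zero h))
      (M.expect_step_ne_top x)

end Model

end BulkQueue

namespace BulkQueue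

open MarkovChain

namespace Model

variable (M : Model)

/-! ### Transitions of positive probability -/

theorem one_le_of_group_ne_zero {g : ℕ} (hg : M.group g ≠ 0) : 1 ≤ g :=
  Nat.one_le_iff_ne_zero.2 fun h => hg (h ▸ M.group_zero)

theorem map_ne_zero {α β : Type} {q : PMF α} {i : α} (f : α → β) (h : q i ≠ 0) :
    q.map f (f i) ≠ 0 :=
  (PMF.mem_support_map_iff f q (f i)).2 ⟨i, h, rfl⟩

theorem bind_ne_zero {α β : Type} {q : PMF α} {k : α → PMF β} {i : α} {z : β} (h : q i ≠ 0)
    (h' : k i z ≠ 0) : q.bind k z ≠ 0 :=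
  (PMF.mem_support_bind_iff q k z).2 ⟨i, h, h'⟩

theorem slotArrivals_group_ne_zero {g : ℕ} (hg : M.group g ≠ 0) : M.slotArrivals g ≠ 0 :=
  bind_ne_zero (i := true) (by simpa [coin] using M.lam_pos) (by simpa using hg)

theorem slotArrivals_zero_ne_zero (hl : M.lam < 1) : M.slotArrivals 0 ≠ 0 :=
  bind_ne_zero (i := false) (by simpa [coin] using hl) (by simp)

theorem arrivalsIn_zero_ne_zero (hl : M.lam < 1) (l : ℕ) : M.arrivalsIn l 0 ≠ 0 := by
  induction l with
  | zero => simp [arrivalsIn]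
  | succ l ih => exact bind_ne_zero ih (map_ne_zero (0 + ·) (M.slotArrivals_zero_ne_zero hl))

theorem arrivalsIn_group_ne_zero (hl : M.lam < 1) {g : ℕ} (hg : M.group g ≠ 0) (l : ℕ) :
    M.arrivalsIn (l + 1) g ≠ 0 := by
  refine bind_ne_zero (M.arrivalsIn_zero_ne_zero hl l) ?_
  have h := map_ne_zero (0 + ·) (M.slotArrivals_group_ne_zero hg)
  rwa [zero_add] at h

theorem arrivalsDuring_zero_ne_zero (hl : M.lam < 1) (T : PMF ℕ) : M.arrivalsDuring T 0 ≠ 0 := by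
  obtain ⟨l, hT⟩ := T.support_nonempty
  exact bind_ne_zero hT (M.arrivalsIn_zero_ne_zero hl l)

theorem arrivalsDuring_group_ne_zero (hl : M.lam < 1) {T : PMF ℕ} (hT : T 0 = 0) {g : ℕ}
    (hg : M.group g ≠ 0) : M.arrivalsDuring T g ≠ 0 := by
  obtain ⟨l, hl'⟩ := T.support_nonempty
  obtain ⟨l, rfl⟩ := Nat.exists_eq_succ_of_ne_zero (n := l) fun h => hl' (h ▸ hT)
  exact bind_ne_zero hl' (M.arrivalsIn_group_ne_zero hl hg l)

theorem exists_startFES_ne_zero (hl : M.lam < 1) {n : ℕ} (hn : M.a ≤ n) :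
    ∃ r, M.startFES n (State.fes (n - min n M.b) r) ≠ 0 := by
  refine ⟨⟨max M.a (min n M.b), Finset.mem_Icc.2 ⟨le_max_left _ _,
    max_le M.a_le_b (min_le_right _ _)⟩⟩, ?_⟩
  have h := map_ne_zero (fun i => State.fes (n - max M.a (min n M.b) + i)
    (⟨max M.a (min n M.b), Finset.mem_Icc.2 ⟨le_max_left _ _,
    max_le M.a_le_b (min_le_right _ _)⟩⟩ : Finset.Icc M.a M.b))
    (M.arrivalsDuring_zero_ne_zero hl (M.fesTime (max M.a (min n M.b))))
  simp only [add_zero] at h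
  rwa [show n - min n M.b = n - max M.a (min n M.b) by
    rw [max_eq_right (le_min hn M.a_le_b)]]

theorem startVac_zero_ne_zero (hl : M.lam < 1) (n : Fin M.a) :
    M.startVac n (State.vac n n) ≠ 0 :=
  map_ne_zero (fun i => State.vac (n + i) n) (M.arrivalsDuring_zero_ne_zero hl _)

theorem startVac_group_ne_zero (hl : M.lam < 1) (n : Fin M.a) {g : ℕ} (hg : M.group g ≠ 0) :
    M.startVac n (State.vac (n + g) n) ≠ 0 :=
  map_ne_zero (fun i => State.vac (n + i) n)
    (M.arrivalsDuring_group_ne_zero hl (M.vacTime_zero n n.2) hg)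

theorem step_fes_ne_zero {n : ℕ} (r : Finset.Icc M.a M.b) {z : State M.a M.b}
    (h : M.afterService n z ≠ 0) : M.step (State.fes n r) z ≠ 0 := by
  refine bind_ne_zero (i := (0 : Fin (r + 1))) ?_ (by simpa using h)
  simpa [optCount, chi] using pow_pos (sub_pos.2 M.p_lt_one) r

theorem step_fes_sos_ne_zero (hl : M.lam < 1) (n : ℕ) (r : Finset.Icc M.a M.b) :
    ∃ j, M.step (State.fes n r) (State.sos n j) ≠ 0 := by
  have hr : 1 ≤ (r : ℕ) := M.one_le_a.trans (Finset.mem_Icc.1 r.2).1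
  refine ⟨⟨1, Finset.mem_Icc.2 ⟨le_rfl, M.b_pos⟩⟩,
    bind_ne_zero (i := (⟨1, Nat.lt_succ_of_le hr⟩ : Fin (r + 1))) ?_ ?_⟩
  · have h1 : 0 < 1 - M.p := sub_pos.2 M.p_lt_one
    have hr' : (0 : ℝ) < (r : ℕ) := Nat.cast_pos.2 hr
    have := M.p_pos
    rw [optCount, PMF.ofFintype_apply, Ne, ENNReal.ofReal_eq_zero, not_le]
    simp only [chi, Nat.choose_one_right]
    positivity
  · rw [dif_neg one_ne_zero]
    exact map_ne_zero (fun i => State.sos (n + i) _) (M.arrivalsDuring_zero_ne_zero hl _)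

/-! ### The dormant period -/

theorem dormantEnd_of_le (f : ℕ) {n : ℕ} (hn : M.a ≤ n) : M.dormantEnd f n = PMF.pure n := by
  cases f with
  | zero => rfl
  | succ f => rw [dormantEnd, if_pos hn]

/-- Groups are nonempty, so the bound on their number is immaterial once it allows the level `a` to
be reached. -/
theorem dormantEnd_eq {f f' n : ℕ} (hf : M.a ≤ n + f) (hf' : M.a ≤ n + f') :
    M.dormantEnd f n = M.dormantEnd f' n := by
  induction f generalizing n f' with
  | zero => rw [M.dormantEnd_of_le _ (n := n) hf, M.dormantEnd_of_le _ (n := n) hf]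
  | succ f ih =>
    by_cases hn : M.a ≤ n
    · rw [M.dormantEnd_of_le _ hn, M.dormantEnd_of_le _ hn]
    obtain ⟨f', rfl⟩ := Nat.exists_eq_succ_of_ne_zero (n := f') fun h => hn (by simpa [h] using hf')
    rw [dormantEnd, dormantEnd, if_neg hn, if_neg hn]
    ext z
    rw [PMF.bind_apply, PMF.bind_apply]
    refine tsum_congr fun i => ?_
    by_cases hi : M.group i = 0
    · rw [hi, zero_mul, zero_mul]
    · have := M.one_le_of_group_ne_zero hi
      rw [ih (f' := f') (by omega) (by omega)]

theorem afterVacation_single (h : M.policy = VacationPolicy.single) (n : ℕ) :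
    M.afterVacation n = (M.dormantEnd M.a n).bind M.startFES := by
  by_cases hn : n < M.a
  · rw [afterVacation, dif_pos hn, h]
  · rw [M.afterVacation_of_le (not_lt.1 hn), M.dormantEnd_of_le _ (not_lt.1 hn), PMF.pure_bind]

/-- A group that joins during dormancy has the same effect as one that came before the vacation
ended. -/
theorem afterVacation_ne_zero_of_add (h : M.policy = VacationPolicy.single) {n g : ℕ}
    (hn : n < M.a) (hg : M.group g ≠ 0) {z : State M.a M.b}
    (hz : M.afterVacation (n + g) z ≠ 0) : M.afterVacation n z ≠ 0 := by
  -- Raising the bound to `a + 1` leaves exactly `a` after one group is split off.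
  rw [M.afterVacation_single h, M.dormantEnd_eq (f' := M.a + 1) (by omega) (by omega),
    dormantEnd, if_neg hn.not_ge, PMF.bind_bind]
  refine bind_ne_zero hg ?_
  rwa [M.afterVacation_single h] at hz

/-! ### Emptying the system -/

theorem exists_step_ne_zero_of_le (hl : M.lam < 1) (x : State M.a M.b) (hx : M.a ≤ x.queue) :
    ∃ r, M.step x (State.fes (x.queue - min x.queue M.b) r) ≠ 0 := by
  obtain ⟨r, hr⟩ := M.exists_startFES_ne_zero hl hx
  refine ⟨r, ?_⟩
  cases x with
  | fes n s => exact M.step_fes_ne_zero s (by rwa [M.afterService_of_le (n := n) hx])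
  | sos n j => rwa [step, M.afterService_of_le (n := n) hx]
  | vac n k => rwa [step, M.afterVacation_of_le (n := n) hx]

theorem afterService_of_lt {n : ℕ} (hn : n < M.a) : M.afterService n = M.startVac ⟨n, hn⟩ := by
  rw [afterService, dif_pos hn]

/-- Usually a vacation begins and one group of size `g` arrives in it. After a single vacation the
group joins during dormancy instead; then only the successors of the intermediate state are reached,
which suffices since the target is not a vacation state. -/
theorem accessible_fes_of_lt (hl : M.lam < 1) (x : State M.a M.b) (hx : x.queue < M.a) {g : ℕ}
    (hg : M.group g ≠ 0) {m : ℕ} {r : Finset.Icc M.a M.b}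
    (h : Accessible M.step (State.vac (x.queue + g) ⟨x.queue, hx⟩) (State.fes m r)) :
    Accessible M.step x (State.fes m r) := by
  have hvac := M.startVac_group_ne_zero hl ⟨x.queue, hx⟩ hg
  cases x with
  | fes n s =>
    refine Accessible.head (M.step_fes_ne_zero s ?_) h
    rwa [M.afterService_of_lt (n := n) hx]
  | sos n j =>
    refine Accessible.head ?_ h
    rwa [step, M.afterService_of_lt (n := n) hx]
  | vac n k =>
    cases hp : M.policy with
    | single =>
      obtain h | ⟨z, hz, hzm⟩ := h.eq_or_exists_step
      · cases h
      · exact Accessible.head (M.afterVacation_ne_zero_of_add hp hx hg hz) hzm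
    | multiple =>
      refine Accessible.head ?_ h
      rw [step, afterVacation, dif_pos (show n < M.a from hx), hp]
      exact hvac

/-- The list holds the groups still to be admitted, one whenever fewer than `a` customers wait;
services otherwise run without arrivals. Full batches preserve the divisibility, so once the list is
used up the queue is a multiple of `b`. The last hypothesis guarantees that some service takes
place. -/
theorem exists_accessible_fes_zero (hl : M.lam < 1) {l : List ℕ} (hmem : ∀ g ∈ l, M.group g ≠ 0)
    (x : State M.a M.b) (hdvd : M.b ∣ x.queue + l.sum) (hne : x.queue ≠ 0 ∨ l ≠ []) :
    ∃ r, Accessible M.step x (State.fes 0 r) := by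
  induction l generalizing x with
  | nil =>
    induction hn : x.queue using Nat.strong_induction_on generalizing x with
    | _ n ih =>
      subst hn
      have hq : x.queue ≠ 0 := by simpa using hne
      have hb : M.b ≤ x.queue := Nat.le_of_dvd (Nat.pos_of_ne_zero hq) (by simpa using hdvd)
      obtain ⟨r, hr⟩ := M.exists_step_ne_zero_of_le hl x (M.a_le_b.trans hb)
      rw [min_eq_right hb] at hr
      by_cases h0 : x.queue - M.b = 0
      · exact ⟨r, Accessible.of_step (h0 ▸ hr)⟩
      · obtain ⟨s, hs⟩ := ih (x.queue - M.b) (Nat.sub_lt (Nat.pos_of_ne_zero hq) M.b_pos)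
          (State.fes (x.queue - M.b) r) (Nat.dvd_sub hdvd (dvd_refl M.b)) (Or.inl h0) rfl
        exact ⟨s, Accessible.head hr hs⟩
  | cons g l ihl =>
    have hg : M.group g ≠ 0 := hmem g List.mem_cons_self
    induction hn : x.queue using Nat.strong_induction_on generalizing x with
    | _ n ih =>
      subst hn
      by_cases hx : x.queue < M.a
      · obtain ⟨r, hr⟩ := ihl (fun k hk => hmem k (List.mem_cons_of_mem g hk))
          (State.vac (x.queue + g) ⟨x.queue, hx⟩)
          (by simpa [State.queue, add_assoc] using hdvd)
          (Or.inl (by have := M.one_le_of_group_ne_zero hg; simp only [State.queue]; omega))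
        exact ⟨r, M.accessible_fes_of_lt hl x hx hg hr⟩
      · obtain ⟨r, hr⟩ := M.exists_step_ne_zero_of_le hl x (not_lt.1 hx)
        obtain hb | hb := le_total x.queue M.b
        -- A batch that takes everybody reaches the goal at once, with groups of the list left over.
        · rw [min_eq_left hb, Nat.sub_self] at hr
          exact ⟨r, Accessible.of_step hr⟩
        · rw [min_eq_right hb] at hr
          have hlt : x.queue - M.b < x.queue := Nat.sub_lt (M.b_pos.trans_le hb) M.b_pos
          obtain ⟨s, hs⟩ := ih (x.queue - M.b) hlt (State.fes (x.queue - M.b) r)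
            (by
              have h := Nat.dvd_sub hdvd (dvd_refl M.b)
              rwa [Nat.sub_add_comm hb] at h)
            (Or.inr (List.cons_ne_nil g l)) rfl
          exact ⟨s, Accessible.head hr hs⟩

/-! ### Queue lengths that occur when the system starts empty -/

/-- The possible total sizes of finitely many groups. -/
def totals : AddSubmonoid ℕ := AddSubmonoid.closure M.group.support

/-- Up to a multiple of `b`, the queue length can be removed by adding further groups. -/
def IsAttainable (n : ℕ) : Prop := ∃ t ∈ M.totals, M.b ∣ n + t

theorem isAttainable_zero : M.IsAttainable 0 := ⟨0, zero_mem _, by simp⟩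

variable {M}

theorem IsAttainable.add {n s : ℕ} (hn : M.IsAttainable n) (hs : s ∈ M.totals) :
    M.IsAttainable (n + s) := by
  obtain ⟨t, ht, hd⟩ := hn
  -- Together with the `s` just added, `b - 1` further copies make a multiple of `b`.
  refine ⟨t + (M.b - 1) • s, add_mem ht (nsmul_mem hs _), ?_⟩
  have h : n + s + (t + (M.b - 1) • s) = n + t + M.b * s := by
    obtain ⟨c, hc⟩ := Nat.exists_eq_succ_of_ne_zero M.b_pos.ne'
    rw [hc, smul_eq_mul]
    simp only [Nat.succ_eq_add_one, Nat.add_sub_cancel]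
    ring
  rw [h]
  exact dvd_add hd (dvd_mul_right _ _)

/-- A full batch changes the queue by `b`, and a smaller one empties it. -/
theorem IsAttainable.sub {n : ℕ} (hn : M.IsAttainable n) :
    M.IsAttainable (n - max M.a (min n M.b)) := by
  obtain hb | hb := le_total n M.b
  · rw [min_eq_left hb, Nat.sub_eq_zero_of_le (le_max_right _ _)]
    exact M.isAttainable_zero
  · obtain ⟨t, ht, hd⟩ := hn
    refine ⟨t, ht, ?_⟩
    rw [min_eq_right hb, max_eq_right M.a_le_b]
    have h := Nat.dvd_sub hd (dvd_refl M.b)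
    rwa [Nat.sub_add_comm hb] at h

variable (M)

theorem group_mem_totals {g : ℕ} (hg : M.group g ≠ 0) : g ∈ M.totals :=
  AddSubmonoid.subset_closure hg

theorem slotArrivals_mem_totals {i : ℕ} (hi : M.slotArrivals i ≠ 0) : i ∈ M.totals := by
  obtain ⟨c, -, hc⟩ := (PMF.mem_support_bind_iff _ _ _).1 ((PMF.mem_support_iff _ _).2 hi)
  cases c with
  | true => exact M.group_mem_totals (by simpa using hc)
  | false =>
    have : i = 0 := by simpa using hc
    exact this ▸ zero_mem _

theorem arrivalsIn_mem_totals {l i : ℕ} (hi : M.arrivalsIn l i ≠ 0) : i ∈ M.totals := by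
  induction l generalizing i with
  | zero =>
    have : i = 0 := by simpa [arrivalsIn] using hi
    exact this ▸ zero_mem _
  | succ l ih =>
    obtain ⟨m, hm, hi⟩ := (PMF.mem_support_bind_iff _ _ _).1 ((PMF.mem_support_iff _ _).2 hi)
    obtain ⟨k, hk, rfl⟩ := (PMF.mem_support_map_iff _ _ _).1 hi
    exact add_mem (ih hm) (M.slotArrivals_mem_totals hk)

theorem arrivalsDuring_mem_totals {T : PMF ℕ} {i : ℕ} (hi : i ∈ (M.arrivalsDuring T).support) :
    i ∈ M.totals := by
  obtain ⟨l, -, hi⟩ := (PMF.mem_support_bind_iff _ _ _).1 hi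
  exact M.arrivalsIn_mem_totals hi

theorem isAttainable_of_startFES {n : ℕ} (hn : M.IsAttainable n) {z : State M.a M.b}
    (hz : M.startFES n z ≠ 0) : M.IsAttainable z.queue := by
  obtain ⟨i, hi, rfl⟩ := (PMF.mem_support_map_iff _ _ _).1 ((PMF.mem_support_iff _ _).2 hz)
  exact hn.sub.add (M.arrivalsDuring_mem_totals hi)

theorem isAttainable_of_startSOS {n : ℕ} (hn : M.IsAttainable n) {j : Finset.Icc 1 M.b}
    {z : State M.a M.b} (hz : M.startSOS n j z ≠ 0) : M.IsAttainable z.queue := by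
  obtain ⟨i, hi, rfl⟩ := (PMF.mem_support_map_iff _ _ _).1 ((PMF.mem_support_iff _ _).2 hz)
  exact hn.add (M.arrivalsDuring_mem_totals hi)

theorem isAttainable_of_startVac {n : Fin M.a} (hn : M.IsAttainable n) {z : State M.a M.b}
    (hz : M.startVac n z ≠ 0) : M.IsAttainable z.queue := by
  obtain ⟨i, hi, rfl⟩ := (PMF.mem_support_map_iff _ _ _).1 ((PMF.mem_support_iff _ _).2 hz)
  exact hn.add (M.arrivalsDuring_mem_totals hi)

theorem isAttainable_of_afterService {n : ℕ} (hn : M.IsAttainable n) {z : State M.a M.b}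
    (hz : M.afterService n z ≠ 0) : M.IsAttainable z.queue := by
  rw [afterService] at hz
  split_ifs at hz with h
  · exact M.isAttainable_of_startVac (n := ⟨n, h⟩) hn hz
  · exact M.isAttainable_of_startFES hn hz

theorem isAttainable_of_dormantEnd {f n m : ℕ} (hn : M.IsAttainable n)
    (hm : M.dormantEnd f n m ≠ 0) : M.IsAttainable m := by
  induction f generalizing n with
  | zero =>
    have : m = n := by simpa [dormantEnd] using hm
    exact this ▸ hn
  | succ f ih =>
    rw [dormantEnd] at hm
    split_ifs at hm with h
    · have : m = n := by simpa using hm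
      exact this ▸ hn
    · obtain ⟨i, hi, hm⟩ := (PMF.mem_support_bind_iff _ _ _).1 ((PMF.mem_support_iff _ _).2 hm)
      exact ih (hn.add (M.group_mem_totals hi)) hm

theorem isAttainable_of_afterVacation {n : ℕ} (hn : M.IsAttainable n) {z : State M.a M.b}
    (hz : M.afterVacation n z ≠ 0) : M.IsAttainable z.queue := by
  cases hp : M.policy with
  | single =>
    rw [M.afterVacation_single hp] at hz
    obtain ⟨m, hm, hz⟩ := (PMF.mem_support_bind_iff _ _ _).1 ((PMF.mem_support_iff _ _).2 hz)
    exact M.isAttainable_of_startFES (M.isAttainable_of_dormantEnd hn hm) hz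
  | multiple =>
    rw [afterVacation, hp] at hz
    split_ifs at hz with h
    · exact M.isAttainable_of_startVac (n := ⟨n, h⟩) hn hz
    · exact M.isAttainable_of_startFES hn hz

theorem isAttainable_of_step {x z : State M.a M.b} (hx : M.IsAttainable x.queue)
    (hz : M.step x z ≠ 0) : M.IsAttainable z.queue := by
  cases x with
  | fes n r =>
    obtain ⟨y, -, hz⟩ := (PMF.mem_support_bind_iff _ _ _).1 ((PMF.mem_support_iff _ _).2 hz)
    split_ifs at hz with h
    · exact M.isAttainable_of_afterService hx hz
    · exact M.isAttainable_of_startSOS hx hz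
  | sos n j => exact M.isAttainable_of_afterService hx hz
  | vac n k => exact M.isAttainable_of_afterVacation hx hz

/-! ### Ergodicity on the states accessible from the empty system -/

theorem exists_accessible_fes_zero_of_isAttainable (hl : M.lam < 1) {x : State M.a M.b}
    (hx : M.IsAttainable x.queue) : ∃ r, Accessible M.step x (State.fes 0 r) := by
  obtain ⟨t, ht, hd⟩ := hx
  obtain ⟨l, hl', rfl⟩ := AddSubmonoid.exists_list_of_mem_closure ht
  obtain ⟨g, hg⟩ := M.group.support_nonempty
  -- The `b` extra copies of `g` keep the divisibility and make the list nonempty.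
  refine M.exists_accessible_fes_zero hl (l := l ++ List.replicate M.b g) ?_ x ?_ (Or.inr ?_)
  · intro k hk
    obtain hk | hk := List.mem_append.1 hk
    · exact hl' k hk
    · rw [List.eq_of_mem_replicate hk]
      exact hg
  · rw [List.sum_append, List.sum_replicate, ← add_assoc, smul_eq_mul]
    exact dvd_add hd (dvd_mul_right _ _)
  · simp [M.b_pos.ne']

theorem afterService_zero_empty_ne_zero (hl : M.lam < 1) : M.afterService 0 M.empty ≠ 0 := by
  rw [M.afterService_of_lt M.one_le_a]
  exact M.startVac_zero_ne_zero hl ⟨0, M.one_le_a⟩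

theorem stepN_one_fes_empty_ne_zero (hl : M.lam < 1) (r : Finset.Icc M.a M.b) :
    stepN M.step 1 (State.fes 0 r) M.empty ≠ 0 :=
  stepN_one_ne_zero (M.step_fes_ne_zero r (M.afterService_zero_empty_ne_zero hl))

theorem stepN_two_fes_empty_ne_zero (hl : M.lam < 1) (r : Finset.Icc M.a M.b) :
    stepN M.step 2 (State.fes 0 r) M.empty ≠ 0 := by
  obtain ⟨j, hj⟩ := M.step_fes_sos_ne_zero hl 0 r
  exact stepN_succ_ne_zero.2 ⟨_, hj, stepN_one_ne_zero (M.afterService_zero_empty_ne_zero hl)⟩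

theorem isErgodicOn (h : M.rho < 1) (hl : M.lam < 1) :
    IsErgodicOn M.step {x | Accessible M.step M.empty x} := by
  have hfes : ∀ x, Accessible M.step M.empty x → ∃ r, Accessible M.step x (State.fes 0 r) :=
    fun x hx => M.exists_accessible_fes_zero_of_isAttainable hl
      (hx.induction (p := fun x => M.IsAttainable x.queue)
        (fun _ _ hx hz => M.isAttainable_of_step hx hz) M.isAttainable_zero)
  have hirr : IsIrreducibleClass M.step {x | Accessible M.step M.empty x} := by
    refine isIrreducibleClass_accessible fun x hx => ?_
    obtain ⟨r, hr⟩ := hfes x hx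
    exact hr.trans ⟨1, M.stepN_one_fes_empty_ne_zero hl r⟩
  refine ⟨hirr, fun x hx => ⟨fun d hd => ?_, (M.isLyapunov h).isPositiveRecurrentAt hirr hx⟩⟩
  obtain ⟨r, m, hm⟩ := hfes x hx
  obtain ⟨k, hk⟩ := hx
  -- Two loops through the same states, with and without a second service, have lengths differing by
  -- one.
  have h1 := hd (m + (1 + k)) (by omega)
    (stepN_add_ne_zero hm (stepN_add_ne_zero (M.stepN_one_fes_empty_ne_zero hl r) hk))
  have h2 := hd (m + (2 + k)) (by omega)
    (stepN_add_ne_zero hm (stepN_add_ne_zero (M.stepN_two_fes_empty_ne_zero hl r) hk))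
  have h3 := Nat.dvd_sub h2 h1
  rwa [show m + (2 + k) - (m + (1 + k)) = 1 by omega, Nat.dvd_one] at h3

end Model

end BulkQueue

/-- The denominator of the generating function has left derivative `b (1 - ρ)` at `1`, and if
`ρ < 1` then the embedded chain is ergodic: every state leads to an irreducible class, every
irreducible class is positive recurrent, and, for `λ < 1`, the chain is ergodic (irreducible,
aperiodic, positive recurrent) on the set of states that can be reached from the empty system. -/
theorem mainTheorem6 (M : BulkQueue.Model) :
    HasDerivWithinAt M.denominator ((M.b : ℝ) * (1 - M.rho)) (Set.Iic 1) 1 ∧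
    (M.rho < 1 →
      (∀ x, ∃ C, MarkovChain.IsIrreducibleClass M.step C ∧
        ∃ y ∈ C, MarkovChain.Accessible M.step x y) ∧
      (∀ C, MarkovChain.IsIrreducibleClass M.step C →
        ∀ x ∈ C, MarkovChain.IsPositiveRecurrentAt M.step x) ∧
      (M.lam < 1 →
        MarkovChain.IsErgodicOn M.step {x | MarkovChain.Accessible M.step M.empty x})) := by
  exact ⟨M.hasDerivWithinAt_denominator, fun h =>
    ⟨(M.isLyapunov h).exists_isIrreducibleClass,
      fun _ hC _ hx => (M.isLyapunov h).isPositiveRecurrentAt hC hx, M.isErgodicOn h⟩⟩
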